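/- Let $P_X$ be the uniform distribution on $\{0,1\}$ and let $P_{Y|X}$ be an arbitrary channel (Markov kernel) from $\{0,1\}$ to an arbitrary measurable space $\mathcal Y$. Let $(X_1,Y_1),(X_2,Y_2),\dots$ be i.i.d. with law $P_X\otimes P_{Y|X}$, and put $X^n=(X_1,\dots,X_n)$, $Y^n=(Y_1,\dots,Y_n)$. For $s>0$ and a random variable $X$ with a finite alphabet let $G_s(X)=\mathbb E[\mathrm{ord}_X(X)^s]$, where $\mathrm{ord}_X(x)\in\{1,2,\dots\}$ is the position of the symbol $x$ when the symbols are sorted by decreasing probability, with ties broken arbitrarily; for a discrete random variable $Z$ let $G_s(X\mid Z)=\mathbb E[\mathrm{ord}_{X|Z}(X\mid Z)^s]$, where $\mathrm{ord}_{X|Z}(x\mid z)$ is the position of $x$ when the symbols are sorted by decreasing conditional probability given $Z=z$. Define the guessing efficiency $$\gamma_s(P_X,P_{Y|X})=\limsup_{n\to\infty}\ \inf_{f}\ \frac{G_s(X^n\mid f(Y^n))}{G_s(X^n)},$$ where $f$ ranges over the measurable functions $\mathcal Y^n\to\{0,1\}$. Let $P_Y$ be the law of the channel output, let $P_{X|Y}$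 be the reverse channel, and let $$\eta=\eta(P_Y,P_{X|Y})=\sup_{Q_Y\ne P_Y}\frac{D(Q_X\|P_X)}{D(Q_Y\|P_Y)}$$ be its strong data-processing constant, where $Q_Y$ ranges over the probability measures on $\mathcal Y$ other than $P_Y$, $Q_X$ is the $X$-marginal of $Q_Y\otimes P_{X|Y}$, $D$ is the Kullback–Leibler divergence, a ratio with infinite denominator counts as $0$, and the supremum over the empty set is $0$. Then for every $s>0$ $$\gamma_s(P_X,P_{Y|X})\ \ge\ e^{-1}\cdot\frac{s^{s-1}(s+1)}{\Gamma(1/s)^s}\cdot 2^{-s\,\eta(P_Y,P_{X|Y})}.$$ -/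

import Mathlib

open MeasureTheory ProbabilityTheory Filter
open scoped ENNReal

namespace GuessingHelp

noncomputable section

/-- A finite alphabet can be listed by decreasing value of any weight function on it. -/
theorem exists_guessingOrder {α : Type*} [Fintype α] (p : α → ℝ) :
    ∃ σ : α ≃ Fin (Fintype.card α), ∀ x x' : α, p x' < p x → σ x < σ x' := by
  classical
  let e := Fintype.equivFin α
  let f : Fin (Fintype.card α) → ℝ := fun i => -(p (e.symm i))
  refine ⟨e.trans (Tuple.sort f).symm, fun x x' h => ?_⟩
  by_contra hlt
  have hmono := Tuple.monotone_sort f (not_lt.mp hlt)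
  simp only [Function.comp_apply, Equiv.trans_apply, Equiv.apply_symm_apply, f,
    Equiv.symm_apply_apply] at hmono
  linarith

/-- The position (`1, 2, 3, …`) of the symbol `x` when the symbols are sorted by decreasing
value of `p`, ties being broken arbitrarily. -/
def ord {α : Type*} [Fintype α] (p : α → ℝ) (x : α) : ℕ :=
  ((exists_guessingOrder p).choose x : ℕ) + 1

/-- The minimal `s`-th order guessing-time moment `G_s(X) = 𝔼[ord_X(X)^s]`. -/
def guessingMoment {Ω α : Type*} [MeasurableSpace Ω] [Fintype α]
    (s : ℝ) (P : Measure Ω) (X : Ω → α) : ℝ :=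
  ∫ ω, (ord (fun x => P.real (X ⁻¹' {x})) (X ω) : ℝ) ^ s ∂P

/-- The minimal conditional `s`-th order guessing-time moment
`G_s(X | Z) = 𝔼[ord_{X|Z}(X | Z)^s]` for a discrete `Z`, where `ord_{X|Z}(· | z)` sorts the
symbols by decreasing conditional probability `ℙ(X = x | Z = z)`. -/
def condGuessingMoment {Ω α β : Type*} [MeasurableSpace Ω] [Fintype α]
    (s : ℝ) (P : Measure Ω) (X : Ω → α) (Z : Ω → β) : ℝ :=
  ∫ ω, (ord (fun x => (P[|Z ⁻¹' {Z ω}]).real (X ⁻¹' {x})) (X ω) : ℝ) ^ s ∂P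

/-- The joint law of `n` independent uses of the channel `W = P_{Y|X}` with i.i.d. inputs of law
`PX`: the coordinates `(X_i, Y_i)` are i.i.d. with law `P_X ⊗ P_{Y|X}`. -/
def blockLaw {𝒳 𝒴 : Type*} [MeasurableSpace 𝒳] [MeasurableSpace 𝒴]
    (PX : Measure 𝒳) (W : Kernel 𝒳 𝒴) (n : ℕ) : Measure (Fin n → 𝒳 × 𝒴) :=
  Measure.pi fun _ => PX ⊗ₘ W

/-- The input block `X^n`. -/
def inputBlock {𝒳 𝒴 : Type*} {n : ℕ} (ω : Fin n → 𝒳 × 𝒴) : Fin n → 𝒳 := fun i => (ω i).1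

/-- The output block `Y^n`. -/
def outputBlock {𝒳 𝒴 : Type*} {n : ℕ} (ω : Fin n → 𝒳 × 𝒴) : Fin n → 𝒴 := fun i => (ω i).2

/-- The guessing efficiency
`γ_s(P_X, P_{Y|X}) = limsup_n inf_f G_s(X^n | f(Y^n)) / G_s(X^n)`,
with `f` ranging over the measurable one-bit functions of `Y^n`. -/
def guessingEfficiency {𝒳 𝒴 : Type*} [Fintype 𝒳] [MeasurableSpace 𝒳] [MeasurableSpace 𝒴]
    (s : ℝ) (PX : Measure 𝒳) (W : Kernel 𝒳 𝒴) : ℝ :=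
  limsup (fun n : ℕ =>
    ⨅ f : {f : (Fin n → 𝒴) → Bool // Measurable f},
      condGuessingMoment s (blockLaw PX W n) inputBlock (fun ω => f.1 (outputBlock ω)) /
        guessingMoment s (blockLaw PX W n) inputBlock) atTop

/-- The strong data-processing constant of a channel `V` with input law `P`:
`η(P, V) = sup_{Q ≠ P} D(V ∘ Q ‖ V ∘ P) / D(Q ‖ P)`, with `Q` ranging over the probability measures
(a ratio with infinite denominator counts as `0`). -/
def sdpiConstant {𝒴 𝒳 : Type*} [MeasurableSpace 𝒴] [MeasurableSpace 𝒳]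
    (P : Measure 𝒴) (V : Kernel 𝒴 𝒳) : ℝ≥0∞ :=
  ⨆ (Q : Measure 𝒴) (_ : IsProbabilityMeasure Q) (_ : Q ≠ P),
    InformationTheory.klDiv (V ∘ₘ Q) (V ∘ₘ P) / InformationTheory.klDiv Q P

/-- The uniform law on the binary alphabet. -/
def uniformBit : Measure Bool := (PMF.uniformOfFintype Bool).toMeasure

instance : IsProbabilityMeasure uniformBit := by unfold uniformBit; infer_instance

end

end GuessingHelp

namespace GuessingHelp

/-! For a one-bit help `f` put `g b x = ℙ(f(Y^n) = b | X^n = x)`. The sum over `b` of the entropies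
of `g b` under the uniform input law is the mutual information between `X^n` and `f(Y^n)`, and it is
bounded from both sides.

Above: the constant `η` of the reverse channel is an entropy contraction constant of the forward
averaging operator (`contractsEnt_sdpiConstant`), and this contraction tensorizes
(`ContractsEnt.pi`), so the sum is at most `η` times the entropy of one bit, hence at most `η log
2`.

Below: Gibbs' inequality against the weights `exp(-l · ord^s)` bounds the sum by `log 2^n` minus a
log-partition function minus `l` times the guessing moment (`le_ent_of_uniform`). Optimizing `l`
(`rpow_lower_bound`) gives a bound on the moment of order `2^(ns)` for every `n`
(`le_condGuessingMoment`). The unaided moment is asymptotically at most `2^(ns) / (s + 1)`, and the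
ratio gives the constant. -/

/-! ### Entropy functional: bounds, chain rule, convexity. -/

/-- The entropy functional `Ent_μ(φ) = ∫ φ log φ - (∫ φ) log (∫ φ)`. -/
noncomputable def ent {α : Type*} [MeasurableSpace α] (μ : Measure α) (φ : α → ℝ) : ℝ :=
  ∫ x, φ x * Real.log (φ x) ∂μ - (∫ x, φ x ∂μ) * Real.log (∫ x, φ x ∂μ)

lemma abs_mul_log_le_one {x : ℝ} (h0 : 0 ≤ x) (h1 : x ≤ 1) : |x * Real.log x| ≤ 1 := by
  rcases h0.eq_or_lt with rfl | h
  · simp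
  · rw [mul_comm]; exact (Real.abs_log_mul_self_lt x h h1).le

lemma mul_log_nonpos_of_le_one {x : ℝ} (h0 : 0 ≤ x) (h1 : x ≤ 1) : x * Real.log x ≤ 0 :=
  mul_nonpos_of_nonneg_of_nonpos h0 (Real.log_nonpos h0 h1)

lemma integrable_of_mem_Icc {α : Type*} [MeasurableSpace α] {μ : Measure α} [IsFiniteMeasure μ]
    {φ : α → ℝ} (hφ : Measurable φ) (h : ∀ x, φ x ∈ Set.Icc (0 : ℝ) 1) : Integrable φ μ :=
  .of_bound hφ.aestronglyMeasurable 1 (ae_of_all _ fun x => by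
    rw [Real.norm_eq_abs, abs_of_nonneg (h x).1]; exact (h x).2)

lemma integrable_mul_log {α : Type*} [MeasurableSpace α] {μ : Measure α} [IsFiniteMeasure μ]
    {φ : α → ℝ} (hφ : Measurable φ) (h : ∀ x, φ x ∈ Set.Icc (0 : ℝ) 1) :
    Integrable (fun x => φ x * Real.log (φ x)) μ :=
  .of_bound (by fun_prop) 1 (ae_of_all _ fun x => abs_mul_log_le_one (h x).1 (h x).2)

lemma integral_mem_Icc {α : Type*} [MeasurableSpace α] {μ : Measure α} [IsProbabilityMeasure μ]
    {φ : α → ℝ} (hφ : Measurable φ) (h : ∀ x, φ x ∈ Set.Icc (0 : ℝ) 1) :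
    ∫ x, φ x ∂μ ∈ Set.Icc (0 : ℝ) 1 := by
  refine ⟨integral_nonneg fun x => (h x).1, ?_⟩
  simpa using integral_mono (μ := μ) (integrable_of_mem_Icc hφ h) (integrable_const (1 : ℝ))
    (fun x => (h x).2)

lemma abs_ent_le_one {α : Type*} [MeasurableSpace α] {μ : Measure α} [IsProbabilityMeasure μ]
    {φ : α → ℝ} (hφ : Measurable φ) (h : ∀ x, φ x ∈ Set.Icc (0 : ℝ) 1) : |ent μ φ| ≤ 1 := by
  have hm := integral_mem_Icc (μ := μ) hφ h
  have h1 := abs_le.1 (abs_mul_log_le_one hm.1 hm.2)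
  have h2 := mul_log_nonpos_of_le_one hm.1 hm.2
  have h3 : ∫ x, φ x * Real.log (φ x) ∂μ ≤ 0 :=
    integral_nonpos fun x => mul_log_nonpos_of_le_one (h x).1 (h x).2
  have h4 : -1 ≤ ∫ x, φ x * Real.log (φ x) ∂μ := by
    simpa using integral_mono (integrable_const (-1 : ℝ)) (integrable_mul_log (μ := μ) hφ h)
      (fun x => (abs_le.1 (abs_mul_log_le_one (h x).1 (h x).2)).1)
  unfold ent
  rw [abs_le]
  constructor <;> linarith

/-- Chain rule: by Fubini, the terms `m log m` of the partial mean `m` cancel between the two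
summands. -/
lemma ent_prod {α β : Type*} [MeasurableSpace α] [MeasurableSpace β] (μ : Measure α)
    (ν : Measure β) [IsProbabilityMeasure μ] [IsProbabilityMeasure ν] {φ : α × β → ℝ}
    (hφ : Measurable φ) (h : ∀ x, φ x ∈ Set.Icc (0 : ℝ) 1) :
    ent (μ.prod ν) φ = ent μ (fun x => ∫ y, φ (x, y) ∂ν) + ∫ x, ent ν (fun y => φ (x, y)) ∂μ := by
  have hm : Measurable fun x => ∫ y, φ (x, y) ∂ν :=
    hφ.stronglyMeasurable.integral_prod_right'.measurable
  have hm1 : ∀ x, ∫ y, φ (x, y) ∂ν ∈ Set.Icc (0 : ℝ) 1 := fun x =>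
    integral_mem_Icc (by fun_prop) fun y => h _
  have hl : Measurable fun x => ∫ y, φ (x, y) * Real.log (φ (x, y)) ∂ν :=
    (by fun_prop : Measurable fun z =>
      φ z * Real.log (φ z)).stronglyMeasurable.integral_prod_right'.measurable
  unfold ent
  rw [integral_prod _ (integrable_mul_log hφ h), integral_prod _ (integrable_of_mem_Icc hφ h),
    integral_sub (integrable_mul_log hφ h).integral_prod_left (integrable_mul_log hm hm1)]
  ring

/-- This is `log t ≤ t - 1` at `t = g' c / (c' g)`, multiplied by `p g`. It is the pointwise form of
the log-sum inequality, with the degenerate case `p g = 0` included. -/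
lemma mul_sub_le_mul_log {p g g' c c' : ℝ} (hp : 0 ≤ p) (hg' : 0 ≤ g')
    (hc : 0 ≤ c) (hc' : 0 ≤ c') (hg : 0 ≤ g) (hpos : p * g ≠ 0 → 0 < g' ∧ 0 < c ∧ 0 < c') :
    p * g - p * g' * c / c' ≤ p * (g * Real.log g) - p * g * Real.log g' -
      p * g * Real.log c + p * g * Real.log c' := by
  by_cases hpg : p * g = 0
  · have : p * (g * Real.log g) = 0 := by rw [← mul_assoc, hpg, zero_mul]
    rw [this, hpg]
    have : 0 ≤ p * g' * c / c' := by positivity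
    linarith
  · obtain ⟨h1, h2, h3⟩ := hpos hpg
    have hg0 : 0 < g := lt_of_le_of_ne hg (fun h => hpg (by simp [← h]))
    have := Real.log_le_sub_one_of_pos (x := g' * c / (c' * g)) (by positivity)
    rw [Real.log_div (by positivity) (by positivity), Real.log_mul h1.ne' h2.ne',
      Real.log_mul h3.ne' hg0.ne'] at this
    have h4 := mul_le_mul_of_nonneg_left this (by positivity : 0 ≤ p * g)
    have h5 : p * g * (g' * c / (c' * g) - 1) = p * g' * c / c' - p * g := by
      field_simp
    rw [h5] at h4
    linarith

/-- Jensen's inequality for the convex functional `ent ν`: it lies above its supporting linear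
functional at the mean `G`, and integrating that functional over `κ` returns `ent ν G`. -/
lemma ent_integral_le {α β : Type*} [Fintype α] [MeasurableSpace α] [MeasurableSingletonClass α]
    [MeasurableSpace β] (ν : Measure α) [IsProbabilityMeasure ν] (κ : Measure β)
    [IsProbabilityMeasure κ] {g : β → α → ℝ} (hg : ∀ x, Measurable fun y => g y x)
    (h : ∀ y x, g y x ∈ Set.Icc (0 : ℝ) 1) :
    ent ν (fun x => ∫ y, g y x ∂κ) ≤ ∫ y, ent ν (g y) ∂κ := by
  set p : α → ℝ := fun x => ν.real {x} with hp
  have hp0 : ∀ x, 0 ≤ p x := fun x => measureReal_nonneg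
  have hsum : ∀ f : α → ℝ, ∫ x, f x ∂ν = ∑ x, p x * f x := fun f => by
    rw [integral_fintype .of_finite]; rfl
  set G : α → ℝ := fun x => ∫ y, g y x ∂κ with hG
  have hGm : ∀ x, G x ∈ Set.Icc (0 : ℝ) 1 := fun x => integral_mem_Icc (hg x) fun y => h y x
  set C : ℝ := ∑ x, p x * G x with hC
  have hint : ∀ x, Integrable (fun y => g y x) κ := fun x =>
    integrable_of_mem_Icc (hg x) fun y => h y x
  -- Makes the convention `Real.log 0 = 0` harmless: almost surely `log (G x)` is multiplied by zero
  -- wherever `G x` vanishes.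
  have hae : ∀ᵐ y ∂κ, ∀ x, G x = 0 → g y x = 0 := by
    rw [ae_all_iff]
    intro x
    by_cases hx : G x = 0
    · filter_upwards [(integral_eq_zero_iff_of_nonneg (fun y => (h y x).1) (hint x)).1 hx]
        with y hy _ using hy
    · exact ae_of_all _ fun y hy => absurd hy hx
  have hC0 : 0 ≤ C := Finset.sum_nonneg fun x _ => mul_nonneg (hp0 x) (hGm x).1
  have hkey : ∀ᵐ y ∂κ, ∑ x, p x * g y x * Real.log (G x) -
      (∑ x, p x * g y x) * Real.log C ≤ ent ν (g y) := by
    filter_upwards [hae] with y hy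
    set c : ℝ := ∑ x, p x * g y x with hc
    have hc0 : 0 ≤ c := Finset.sum_nonneg fun x _ => mul_nonneg (hp0 x) (h y x).1
    have hle : ∀ x, p x * g y x - p x * G x * c / C ≤ p x * (g y x * Real.log (g y x)) -
        p x * g y x * Real.log (G x) - p x * g y x * Real.log c + p x * g y x * Real.log C := by
      intro x
      refine mul_sub_le_mul_log (hp0 x) (hGm x).1 hc0 hC0 (h y x).1 fun hne => ?_
      have hGx : 0 < G x := lt_of_le_of_ne (hGm x).1 fun h' => hne (by rw [hy x h'.symm, mul_zero])
      have hpx : 0 < p x := lt_of_le_of_ne (hp0 x) fun h' => hne (by rw [← h', zero_mul])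
      refine ⟨hGx, ?_, ?_⟩
      · exact lt_of_lt_of_le (lt_of_le_of_ne (mul_nonneg (hp0 x) (h y x).1) hne.symm)
          (Finset.single_le_sum (f := fun x => p x * g y x)
            (fun x _ => mul_nonneg (hp0 x) (h y x).1) (Finset.mem_univ x))
      · exact lt_of_lt_of_le (mul_pos hpx hGx)
          (Finset.single_le_sum (f := fun x => p x * G x)
            (fun x _ => mul_nonneg (hp0 x) (hGm x).1) (Finset.mem_univ x))
    have hs := Finset.sum_le_sum fun x (_ : x ∈ Finset.univ) => hle x
    simp only [Finset.sum_sub_distrib, Finset.sum_add_distrib, ← Finset.sum_mul,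
      ← Finset.sum_div] at hs
    rw [← hc, ← hC] at hs
    have h0 : 0 ≤ c - C * c / C := by
      by_cases hC' : C = 0
      · simp [hC', hc0]
      · rw [mul_div_right_comm, div_self hC', one_mul, sub_self]
    unfold ent
    rw [hsum, hsum, ← hc]
    linarith
  have hint2 : Integrable (fun y => ∑ x, p x * g y x * Real.log (G x) -
      (∑ x, p x * g y x) * Real.log C) κ :=
    (integrable_finsetSum _ fun x _ => ((hint x).const_mul _).mul_const _).sub
      ((integrable_finsetSum _ fun x _ => (hint x).const_mul _).mul_const _)
  have hent : Integrable (fun y => ent ν (g y)) κ := by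
    refine .of_bound (Measurable.aestronglyMeasurable ?_) 1
      (ae_of_all _ fun y => abs_ent_le_one (measurable_of_finite _) (h y))
    unfold ent
    simp only [hsum]
    fun_prop
  refine le_trans (le_of_eq ?_) (integral_mono_ae hint2 hent hkey)
  rw [integral_sub (integrable_finsetSum _ fun x _ => ((hint x).const_mul _).mul_const _)
      ((integrable_finsetSum _ fun x _ => (hint x).const_mul _).mul_const _),
    integral_finsetSum _ fun x _ => ((hint x).const_mul _).mul_const _, integral_mul_const,
    integral_finsetSum _ fun x _ => (hint x).const_mul _]
  simp only [integral_mul_const, integral_const_mul]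
  unfold ent
  rw [hsum, hsum]
  simp only [mul_assoc, hC, hG]

/-! ### Entropy contraction and its tensorization. -/

/-- The channel `K` with input law `ν` and output law `μ` contracts entropy by the factor `η`. -/
structure ContractsEnt {α β : Type*} [MeasurableSpace α] [MeasurableSpace β] (η : ℝ)
    (ν : Measure α) (K : α → Measure β) (μ : Measure β) : Prop where
  integral_integral : ∀ φ : β → ℝ, Measurable φ → (∀ y, |φ y| ≤ 1) →
    ∫ x, ∫ y, φ y ∂K x ∂ν = ∫ y, φ y ∂μ
  ent_le : ∀ φ : β → ℝ, Measurable φ → (∀ y, φ y ∈ Set.Icc (0 : ℝ) 1) →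
    ent ν (fun x => ∫ y, φ y ∂K x) ≤ η * ent μ φ

lemma integrable_of_abs_le_one {α : Type*} [MeasurableSpace α] {μ : Measure α} [IsFiniteMeasure μ]
    {φ : α → ℝ} (hφ : Measurable φ) (h : ∀ x, |φ x| ≤ 1) : Integrable φ μ :=
  .of_bound hφ.aestronglyMeasurable 1 (ae_of_all _ fun x => h x)

lemma abs_integral_le_one {α : Type*} [MeasurableSpace α] {μ : Measure α} [IsProbabilityMeasure μ]
    {φ : α → ℝ} (h : ∀ x, |φ x| ≤ 1) : |∫ x, φ x ∂μ| ≤ 1 := by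
  simpa using norm_integral_le_of_norm_le_const (μ := μ) (f := φ) (ae_of_all _ h)

lemma abs_le_one_of_mem_Icc {x : ℝ} (h : x ∈ Set.Icc (0 : ℝ) 1) : |x| ≤ 1 := by
  rw [abs_of_nonneg h.1]; exact h.2

lemma integral_integral_comm_finite {α β : Type*} [Fintype α] [MeasurableSpace α]
    [MeasurableSingletonClass α] [MeasurableSpace β] (ν : Measure α) [IsProbabilityMeasure ν]
    (κ : Measure β) [IsProbabilityMeasure κ] {g : β → α → ℝ} (hg : ∀ x, Measurable fun y => g y x)
    (h : ∀ y x, |g y x| ≤ 1) : ∫ x, ∫ y, g y x ∂κ ∂ν = ∫ y, ∫ x, g y x ∂ν ∂κ := by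
  simp only [integral_fintype (μ := ν) .of_finite, smul_eq_mul]
  rw [integral_finsetSum _ fun x _ => (integrable_of_abs_le_one (hg x) fun y => h y x).const_mul _]
  simp only [integral_const_mul]

/-- The chain rule splits both entropies. The marginal terms compare by contraction of the first
channel; the conditional terms by convexity followed by contraction of the second channel. -/
lemma ContractsEnt.prod {α₁ α₂ β₁ β₂ : Type*} [Fintype α₁] [MeasurableSpace α₁]
    [MeasurableSingletonClass α₁] [Fintype α₂] [MeasurableSpace α₂] [MeasurableSingletonClass α₂]
    [MeasurableSpace β₁] [MeasurableSpace β₂] {η : ℝ}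
    {ν₁ : Measure α₁} {K₁ : α₁ → Measure β₁} {μ₁ : Measure β₁}
    {ν₂ : Measure α₂} {K₂ : α₂ → Measure β₂} {μ₂ : Measure β₂}
    [IsProbabilityMeasure ν₁] [IsProbabilityMeasure ν₂] [IsProbabilityMeasure μ₁]
    [IsProbabilityMeasure μ₂] [∀ x, IsProbabilityMeasure (K₁ x)] [∀ x, IsProbabilityMeasure (K₂ x)]
    (h₁ : ContractsEnt η ν₁ K₁ μ₁) (h₂ : ContractsEnt η ν₂ K₂ μ₂) :
    ContractsEnt η (ν₁.prod ν₂) (fun x => (K₁ x.1).prod (K₂ x.2)) (μ₁.prod μ₂) := by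
  have hGmeas : ∀ φ : β₁ × β₂ → ℝ, Measurable φ → ∀ x₂,
      Measurable fun y₁ => ∫ y₂, φ (y₁, y₂) ∂K₂ x₂ := fun φ hφ x₂ =>
    hφ.stronglyMeasurable.integral_prod_right'.measurable
  constructor
  · intro φ hφ hb
    have hGb : ∀ y₁ x₂, |∫ y₂, φ (y₁, y₂) ∂K₂ x₂| ≤ 1 := fun y₁ x₂ =>
      abs_integral_le_one fun y₂ => hb _
    rw [integral_prod _ .of_finite, integral_prod _ (integrable_of_abs_le_one hφ hb)]
    rw [← h₁.integral_integral (fun y₁ => ∫ y₂, φ (y₁, y₂) ∂μ₂)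
      hφ.stronglyMeasurable.integral_prod_right'.measurable
      fun y₁ => abs_integral_le_one fun y₂ => hb _]
    refine integral_congr_ae (ae_of_all _ fun x₁ => ?_)
    simp only [integral_prod _ (integrable_of_abs_le_one hφ hb)]
    rw [integral_integral_comm_finite ν₂ (K₁ x₁) (hGmeas φ hφ) hGb]
    refine integral_congr_ae (ae_of_all _ fun y₁ => ?_)
    exact h₂.integral_integral (fun y₂ => φ (y₁, y₂)) (by fun_prop) fun y₂ => hb _
  · intro φ hφ hb
    have hb1 : ∀ y, |φ y| ≤ 1 := fun y => abs_le_one_of_mem_Icc (hb y)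
    have hG : ∀ y₁ x₂, ∫ y₂, φ (y₁, y₂) ∂K₂ x₂ ∈ Set.Icc (0 : ℝ) 1 := fun y₁ x₂ =>
      integral_mem_Icc (by fun_prop) fun y₂ => hb _
    have hH : ∀ y₁, ∫ x₂, ∫ y₂, φ (y₁, y₂) ∂K₂ x₂ ∂ν₂ = ∫ y₂, φ (y₁, y₂) ∂μ₂ := fun y₁ =>
      h₂.integral_integral (fun y₂ => φ (y₁, y₂)) (by fun_prop) fun y₂ => hb1 _
    have hentm : Measurable fun y₁ => ent μ₂ fun y₂ => φ (y₁, y₂) := by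
      have hl : Measurable fun y₁ => ∫ y₂, φ (y₁, y₂) * Real.log (φ (y₁, y₂)) ∂μ₂ :=
        (by fun_prop : Measurable fun z =>
          φ z * Real.log (φ z)).stronglyMeasurable.integral_prod_right'.measurable
      have hm : Measurable fun y₁ => ∫ y₂, φ (y₁, y₂) ∂μ₂ :=
        hφ.stronglyMeasurable.integral_prod_right'.measurable
      unfold ent
      fun_prop
    -- The mean identity of `h₁` is applied below to this entropy as a function of `y₁`; it
    -- therefore covers signed functions bounded by `1`.
    have hentb : ∀ y₁, |ent μ₂ fun y₂ => φ (y₁, y₂)| ≤ 1 := fun y₁ =>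
      abs_ent_le_one (by fun_prop) fun y₂ => hb _
    have hentm' : Measurable fun y₁ => ent ν₂ fun x₂ => ∫ y₂, φ (y₁, y₂) ∂K₂ x₂ := by
      unfold ent
      simp only [integral_fintype (μ := ν₂) .of_finite]
      have := hGmeas φ hφ
      fun_prop
    simp only [integral_prod _ (integrable_of_mem_Icc hφ hb)]
    rw [ent_prod ν₁ ν₂ (measurable_of_finite _) fun x => integral_mem_Icc (hGmeas φ hφ _)
      fun y => hG _ _, ent_prod μ₁ μ₂ hφ hb, mul_add]
    refine add_le_add ?_ ?_
    -- Averaging out `x₂` turns the second channel into its output law, leaving the first channel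
    -- applied to a marginal of `φ`.
    · have : (fun x₁ => ∫ x₂, ∫ y₁, ∫ y₂, φ (y₁, y₂) ∂K₂ x₂ ∂K₁ x₁ ∂ν₂) =
          fun x₁ => ∫ y₁, ∫ y₂, φ (y₁, y₂) ∂μ₂ ∂K₁ x₁ := by
        funext x₁
        rw [integral_integral_comm_finite ν₂ (K₁ x₁) (hGmeas φ hφ)
          fun y₁ x₂ => abs_le_one_of_mem_Icc (hG y₁ x₂)]
        simp only [hH]
      rw [this]
      exact h₁.ent_le _ hφ.stronglyMeasurable.integral_prod_right'.measurable
        fun y₁ => integral_mem_Icc (by fun_prop) fun y₂ => hb _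
    · rw [← h₁.integral_integral _ hentm hentb, ← integral_const_mul]
      refine integral_mono .of_finite .of_finite fun x₁ => ?_
      refine (ent_integral_le ν₂ (K₁ x₁) (hGmeas φ hφ) hG).trans ?_
      rw [← integral_const_mul]
      refine integral_mono (integrable_of_abs_le_one hentm' fun y₁ =>
        abs_ent_le_one (measurable_of_finite _) (hG y₁))
        ((integrable_of_abs_le_one hentm hentb).const_mul _) fun y₁ => ?_
      exact h₂.ent_le _ (by fun_prop) fun y₂ => hb _

lemma ent_comp_measurePreserving {α α' : Type*} [MeasurableSpace α] [MeasurableSpace α']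
    {μ' : Measure α'} {μ : Measure α} (e : α' ≃ᵐ α) (he : MeasurePreserving e μ' μ) (φ : α → ℝ) :
    ent μ' (fun x => φ (e x)) = ent μ φ := by
  unfold ent
  rw [he.integral_comp' φ, he.integral_comp' fun x => φ x * Real.log (φ x)]

lemma ContractsEnt.congr {α β α' β' : Type*} [MeasurableSpace α] [MeasurableSpace β]
    [MeasurableSpace α'] [MeasurableSpace β'] {η : ℝ}
    {ν : Measure α} {K : α → Measure β} {μ : Measure β}
    {ν' : Measure α'} {K' : α' → Measure β'} {μ' : Measure β'} (e : α' ≃ᵐ α) (e' : β' ≃ᵐ β)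
    (hν : MeasurePreserving e ν' ν) (hμ : MeasurePreserving e' μ' μ)
    (hK : ∀ x, MeasurePreserving e' (K' x) (K (e x))) (h : ContractsEnt η ν K μ) :
    ContractsEnt η ν' K' μ' := by
  have hint : ∀ (φ : β' → ℝ) x, ∫ y, φ y ∂K' x = ∫ y, φ (e'.symm y) ∂K (e x) := fun φ x => by
    rw [← (hK x).integral_comp']
    simp
  constructor
  · intro φ hφ hb
    simp only [hint]
    rw [hν.integral_comp' (fun x => ∫ y, φ (e'.symm y) ∂K x),
      h.integral_integral (fun y => φ (e'.symm y)) (by fun_prop) fun y => hb _,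
      ← hμ.integral_comp']
    simp
  · intro φ hφ hb
    simp only [hint]
    rw [ent_comp_measurePreserving e hν (fun x => ∫ y, φ (e'.symm y) ∂K x)]
    refine (h.ent_le (fun y => φ (e'.symm y)) (by fun_prop) fun y => hb _).trans (le_of_eq ?_)
    rw [← ent_comp_measurePreserving e' hμ]
    simp

/-- Entropy contraction tensorizes. -/
lemma ContractsEnt.pi {α β : Type*} [Fintype α] [MeasurableSpace α]
    [MeasurableSingletonClass α] [MeasurableSpace β] {η : ℝ}
    {ν : Measure α} {K : α → Measure β} {μ : Measure β}
    [IsProbabilityMeasure ν] [IsProbabilityMeasure μ] [∀ x, IsProbabilityMeasure (K x)]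
    (h : ContractsEnt η ν K μ) (n : ℕ) :
    ContractsEnt η (Measure.pi fun _ : Fin n => ν) (fun x => Measure.pi fun i => K (x i))
      (Measure.pi fun _ : Fin n => μ) := by
  induction n with
  | zero =>
    refine ⟨fun φ _ _ => ?_, fun φ _ _ => ?_⟩
    · simp [integral_unique]
    · simp [ent, integral_unique]
  | succ n ih =>
    refine (h.prod ih).congr (MeasurableEquiv.piFinSuccAbove (fun _ => α) 0)
      (MeasurableEquiv.piFinSuccAbove (fun _ => β) 0)
      (measurePreserving_piFinSuccAbove (fun _ => ν) 0)
      (measurePreserving_piFinSuccAbove (fun _ => μ) 0) fun x => ?_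
    exact measurePreserving_piFinSuccAbove (fun i => K (x i)) 0

/-! ### From the data-processing constant to entropy contraction. -/

lemma ent_eq_zero_of_integral_eq_zero {α : Type*} [MeasurableSpace α] {μ : Measure α}
    [IsProbabilityMeasure μ] {φ : α → ℝ} (hφ : Measurable φ)
    (h : ∀ x, φ x ∈ Set.Icc (0 : ℝ) 1) (h0 : ∫ x, φ x ∂μ = 0) : ent μ φ = 0 := by
  have hae := (integral_eq_zero_iff_of_nonneg (fun x => (h x).1) (integrable_of_mem_Icc hφ h)).1 h0
  have : ∫ x, φ x * Real.log (φ x) ∂μ = 0 := by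
    refine integral_eq_zero_of_ae ?_
    filter_upwards [hae] with x hx
    simp only [Pi.zero_apply] at hx
    simp [hx]
  simp [ent, this, h0]

/-- The measure with density `φ / c` with respect to `μ`. -/
noncomputable def tilt {α : Type*} [MeasurableSpace α] (μ : Measure α) (φ : α → ℝ) (c : ℝ) :
    Measure α :=
  μ.withDensity fun x => ENNReal.ofReal (φ x / c)

section tilt

variable {α : Type*} [MeasurableSpace α] {μ : Measure α} [IsProbabilityMeasure μ] {φ : α → ℝ}
  {c : ℝ}

lemma isProbabilityMeasure_tilt (hφ : Measurable φ) (h : ∀ x, φ x ∈ Set.Icc (0 : ℝ) 1)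
    (hc : ∫ x, φ x ∂μ = c) (hc0 : 0 < c) : IsProbabilityMeasure (tilt μ φ c) := by
  refine ⟨?_⟩
  rw [tilt, withDensity_apply _ .univ, Measure.restrict_univ,
    ← ofReal_integral_eq_lintegral_ofReal ((integrable_of_mem_Icc hφ h).div_const c)
    (ae_of_all _ fun x => div_nonneg (h x).1 hc0.le), integral_div, hc, div_self hc0.ne',
    ENNReal.ofReal_one]

lemma klFun_tilt (hc0 : 0 < c) {x : ℝ} (hx : 0 ≤ x) :
    InformationTheory.klFun (x / c) =
      (x * Real.log x) / c - x * (Real.log c / c) + 1 - x / c := by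
  unfold InformationTheory.klFun
  rcases hx.eq_or_lt with rfl | hx
  · simp
  · rw [Real.log_div hx.ne' hc0.ne']
    field_simp

lemma klDiv_tilt (hφ : Measurable φ) (h : ∀ x, φ x ∈ Set.Icc (0 : ℝ) 1)
    (hc : ∫ x, φ x ∂μ = c) (hc0 : 0 < c) :
    InformationTheory.klDiv (tilt μ φ c) μ ≠ ∞ ∧
      (InformationTheory.klDiv (tilt μ φ c) μ).toReal = ent μ φ / c := by
  have := isProbabilityMeasure_tilt hφ h hc hc0
  have hac : tilt μ φ c ≪ μ := withDensity_absolutelyContinuous _ _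
  have hrn : (fun x => InformationTheory.klFun ((tilt μ φ c).rnDeriv μ x).toReal) =ᵐ[μ]
      fun x => (φ x * Real.log (φ x)) / c - φ x * (Real.log c / c) + 1 - φ x / c := by
    filter_upwards [Measure.rnDeriv_withDensity μ
      (by fun_prop : Measurable fun x => ENNReal.ofReal (φ x / c))] with x hx
    rw [tilt, hx, ENNReal.toReal_ofReal (div_nonneg (h x).1 hc0.le), klFun_tilt hc0 (h x).1]
  have i1 : Integrable φ μ := integrable_of_mem_Icc hφ h
  have i2 := integrable_mul_log (μ := μ) hφ h
  have i3 : Integrable (fun x => (φ x * Real.log (φ x)) / c - φ x * (Real.log c / c)) μ :=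
    (i2.div_const c).sub (i1.mul_const _)
  have i4 : Integrable (fun x => (φ x * Real.log (φ x)) / c - φ x * (Real.log c / c) + 1) μ :=
    i3.add (integrable_const 1)
  refine ⟨InformationTheory.klDiv_ne_top hac ?_, ?_⟩
  · rw [← InformationTheory.integrable_klFun_rnDeriv_iff hac]
    exact (integrable_congr hrn).2 (i4.sub (i1.div_const c))
  · rw [InformationTheory.toReal_klDiv_eq_integral_klFun hac, integral_congr_ae hrn,
      integral_sub i4 (i1.div_const c), integral_add i3 (integrable_const 1),
      integral_sub (i2.div_const c) (i1.mul_const _), integral_div, integral_mul_const,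
      integral_div, hc, ent, hc]
    simp
    field_simp
    ring

end tilt

/-- Bayes' rule: reweight the joint law of input and output by `φ(y) / c`. Both sides are its input
marginal, disintegrated through the posterior (`e1`) or through `W` (`e2`). -/
lemma posterior_comp_tilt {α β : Type*} [MeasurableSpace α] [StandardBorelSpace α] [Nonempty α]
    [MeasurableSpace β] (W : Kernel α β) [IsMarkovKernel W] (ν : Measure α)
    [IsProbabilityMeasure ν] {φ : β → ℝ} (hφ : Measurable φ)
    (h : ∀ x, φ x ∈ Set.Icc (0 : ℝ) 1) {c : ℝ} (hc0 : 0 < c) :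
    (posterior W ν) ∘ₘ (tilt (W ∘ₘ ν) φ c) = tilt ν (fun x => ∫ y, φ y ∂W x) c := by
  ext s hs
  have hψ : Measurable fun y => ENNReal.ofReal (φ y / c) := by fun_prop
  have hF : Measurable fun z : β × α => ENNReal.ofReal (φ z.1 / c) * s.indicator 1 z.2 :=
    (hψ.comp measurable_fst).mul ((measurable_one.indicator hs).comp measurable_snd)
  have e1 : ∫⁻ z, ENNReal.ofReal (φ z.1 / c) * s.indicator 1 z.2
      ∂((W ∘ₘ ν) ⊗ₘ posterior W ν) = (posterior W ν ∘ₘ tilt (W ∘ₘ ν) φ c) s := by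
    rw [Measure.lintegral_compProd hF, Measure.bind_apply hs (Kernel.aemeasurable _), tilt,
      lintegral_withDensity_eq_lintegral_mul _ hψ (Kernel.measurable_coe _ hs)]
    refine lintegral_congr fun y => ?_
    change ∫⁻ b, ENNReal.ofReal (φ y / c) * s.indicator (1 : α → ℝ≥0∞) b ∂(posterior W ν y) = _
    rw [lintegral_const_mul _ (measurable_one.indicator hs), lintegral_indicator_one hs]
    rfl
  have e2 : ∫⁻ z, ENNReal.ofReal (φ z.1 / c) * s.indicator 1 z.2
      ∂((W ∘ₘ ν) ⊗ₘ posterior W ν) = tilt ν (fun x => ∫ y, φ y ∂W x) c s := by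
    rw [compProd_posterior_eq_map_swap, lintegral_map hF measurable_swap]
    refine (Measure.lintegral_compProd (hF.comp measurable_swap)).trans ?_
    rw [tilt, withDensity_apply _ hs, ← lintegral_indicator hs]
    refine lintegral_congr fun x => ?_
    simp only [Function.comp_apply, Prod.fst_swap, Prod.snd_swap]
    rw [lintegral_mul_const _ hψ, ← ofReal_integral_eq_lintegral_ofReal
      ((integrable_of_mem_Icc hφ h).div_const c)
      (ae_of_all _ fun x => div_nonneg (h x).1 hc0.le), integral_div]
    by_cases hx : x ∈ s <;> simp [hx]
  rw [← e1, e2]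

lemma sdpiConstant_le_one {α β : Type*} [MeasurableSpace α] [MeasurableSpace β] (P : Measure α)
    [IsProbabilityMeasure P] (V : Kernel α β) [IsMarkovKernel V] : sdpiConstant P V ≤ 1 := by
  refine iSup_le fun Q => iSup_le fun hQ => iSup_le fun _ => ENNReal.div_le_of_le_mul ?_
  rw [one_mul]
  exact InformationTheory.klDiv_comp_right_le Q P V

lemma klDiv_comp_le_sdpiConstant_mul {α β : Type*} [MeasurableSpace α] [MeasurableSpace β]
    (P : Measure α) [IsProbabilityMeasure P] (V : Kernel α β) [IsMarkovKernel V] (Q : Measure α)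
    [IsProbabilityMeasure Q] (hQ : InformationTheory.klDiv Q P ≠ ∞) :
    InformationTheory.klDiv (V ∘ₘ Q) (V ∘ₘ P) ≤
      sdpiConstant P V * InformationTheory.klDiv Q P := by
  by_cases hne : Q = P
  · simp [hne]
  · rw [← ENNReal.div_le_iff_le_mul (.inl (by rwa [Ne, InformationTheory.klDiv_eq_zero_iff]))
      (.inl hQ)]
    exact le_iSup_of_le Q (le_iSup_of_le inferInstance (le_iSup_of_le hne le_rfl))

/-- Take `Q` to be the output law tilted by `φ`. Its divergence is `ent φ / c`, and the reverse
channel sends it to the input law tilted by the channel average of `φ`, with the same `c`, which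
cancels. -/
lemma contractsEnt_sdpiConstant {α β : Type*} [Fintype α] [MeasurableSpace α]
    [MeasurableSingletonClass α] [StandardBorelSpace α] [Nonempty α] [MeasurableSpace β]
    (W : Kernel α β) [IsMarkovKernel W] (ν : Measure α) [IsProbabilityMeasure ν] :
    ContractsEnt (sdpiConstant (W ∘ₘ ν) (posterior W ν)).toReal ν W (W ∘ₘ ν) := by
  have hmean : ∀ φ : β → ℝ, Measurable φ → (∀ y, |φ y| ≤ 1) →
      ∫ x, ∫ y, φ y ∂W x ∂ν = ∫ y, φ y ∂(W ∘ₘ ν) := fun φ hφ hb => by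
    rw [← Measure.snd_compProd, Measure.snd, integral_map (by fun_prop) hφ.aestronglyMeasurable,
      Measure.integral_compProd (integrable_of_abs_le_one (by fun_prop) fun y => hb _)]
  refine ⟨hmean, fun φ hφ hb => ?_⟩
  have hT : ∀ x, ∫ y, φ y ∂W x ∈ Set.Icc (0 : ℝ) 1 := fun x => integral_mem_Icc hφ hb
  have hTm : Measurable fun x => ∫ y, φ y ∂W x := measurable_of_finite _
  have hTφ := hmean φ hφ fun y => abs_le_one_of_mem_Icc (hb y)
  set c := ∫ y, φ y ∂(W ∘ₘ ν) with hc
  rcases (integral_mem_Icc (μ := W ∘ₘ ν) hφ hb).1.eq_or_lt with h0 | hc0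
  · rw [ent_eq_zero_of_integral_eq_zero hTm hT (hTφ.trans h0.symm),
      ent_eq_zero_of_integral_eq_zero hφ hb h0.symm, mul_zero]
  · obtain ⟨k1, k2⟩ := klDiv_tilt hφ hb hc.symm hc0
    obtain ⟨-, k4⟩ := klDiv_tilt hTm hT hTφ hc0
    have := isProbabilityMeasure_tilt hφ hb hc.symm hc0
    have key := klDiv_comp_le_sdpiConstant_mul (W ∘ₘ ν) (posterior W ν) (tilt (W ∘ₘ ν) φ c) k1
    rw [posterior_comp_tilt W ν hφ hb hc0, posterior_comp_self] at key
    -- Finiteness of the constant is what allows passing to `toReal`.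
    have hS := sdpiConstant_le_one (W ∘ₘ ν) (posterior W ν)
    have := ENNReal.toReal_mono (ENNReal.mul_ne_top (hS.trans_lt ENNReal.one_lt_top).ne k1) key
    rw [ENNReal.toReal_mul, k2, k4, ← mul_div_assoc] at this
    exact (div_le_div_iff_of_pos_right hc0).1 this

/-! ### Entropy against guessing order. -/

lemma sum_ord {α : Type*} [Fintype α] (p : α → ℝ) (F : ℕ → ℝ) :
    ∑ x, F (ord p x) = ∑ i ∈ Finset.range (Fintype.card α), F (i + 1) := by
  unfold ord
  rw [Finset.sum_range]
  exact Equiv.sum_comp (exists_guessingOrder p).choose fun i => F (i + 1)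

lemma one_le_ord {α : Type*} [Fintype α] (p : α → ℝ) (x : α) : 1 ≤ ord p x := Nat.le_add_left 1 _

lemma sum_exp_neg_ord_le {α : Type*} [Fintype α] (p : α → ℝ) {s l : ℝ} (hs : 0 < s) (hl : 0 < l) :
    ∑ x, Real.exp (-l * (ord p x : ℝ) ^ s) ≤ l ^ (-1 / s) * Real.Gamma (1 / s + 1) := by
  rw [sum_ord p fun k => Real.exp (-l * (k : ℝ) ^ s), ← integral_exp_neg_mul_rpow hs hl]
  refine AntitoneOn.sum_range_le_integral (f := fun x : ℝ => Real.exp (-l * x ^ s)) ?_ ?_ ?_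
  · intro x hx y hy hxy
    have := Real.rpow_le_rpow hx.1 hxy hs.le
    simp only [Real.exp_le_exp, neg_mul]
    gcongr
  -- A non-integrable function would have integral `0`, while the known value is positive.
  · by_contra hn
    have h := integral_exp_neg_mul_rpow hs hl
    rw [integral_undef hn] at h
    have : 0 < l ^ (-1 / s) * Real.Gamma (1 / s + 1) :=
      mul_pos (by positivity) (Real.Gamma_pos_of_pos (by positivity))
    linarith
  · intro t _
    positivity

/-- Gibbs' inequality for unnormalized weights. -/
lemma sum_mul_log_sub_le {α : Type*} [Fintype α] (w r : α → ℝ) (hw : ∀ x, 0 ≤ w x)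
    (hr : ∀ x, 0 < r x) :
    (∑ x, w x) * Real.log (∑ x, w x) - (∑ x, w x) * Real.log (∑ x, r x) ≤
      ∑ x, w x * Real.log (w x) - ∑ x, w x * Real.log (r x) := by
  set A := ∑ x, w x with hA
  set R := ∑ x, r x with hR
  have hA0 : 0 ≤ A := Finset.sum_nonneg fun x _ => hw x
  have hR0 : 0 ≤ R := Finset.sum_nonneg fun x _ => (hr x).le
  have hle : ∀ x, 1 * w x - 1 * r x * A / R ≤ 1 * (w x * Real.log (w x)) -
      1 * w x * Real.log (r x) - 1 * w x * Real.log A + 1 * w x * Real.log R := fun x => by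
    refine mul_sub_le_mul_log zero_le_one (hr x).le hA0 hR0 (hw x) fun hne => ⟨hr x, ?_, ?_⟩
    · rw [one_mul] at hne
      exact lt_of_lt_of_le (lt_of_le_of_ne (hw x) hne.symm)
        (Finset.single_le_sum (fun x _ => hw x) (Finset.mem_univ x))
    · exact lt_of_lt_of_le (hr x)
        (Finset.single_le_sum (fun x _ => (hr x).le) (Finset.mem_univ x))
  have hs := Finset.sum_le_sum fun x (_ : x ∈ Finset.univ) => hle x
  simp only [one_mul, Finset.sum_sub_distrib, Finset.sum_add_distrib, ← Finset.sum_mul,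
    ← Finset.sum_div] at hs
  rw [← hA, ← hR] at hs
  have h0 : 0 ≤ A - R * A / R := by
    by_cases hR' : R = 0
    · simp [hR', hA0]
    · rw [mul_div_right_comm, div_self hR', one_mul, sub_self]
  linarith

/-- Gibbs' inequality with weights `exp(-l · ord^s)`. Only the bijectivity of the ordering matters,
so `p` is arbitrary and need not be related to `g`. -/
lemma le_ent_of_uniform {α : Type*} [Fintype α] [Nonempty α] [MeasurableSpace α]
    [MeasurableSingletonClass α] (ν : Measure α) [IsProbabilityMeasure ν]
    (hν : ∀ x, ν.real {x} = (Fintype.card α : ℝ)⁻¹) (g : α → ℝ) (hg : ∀ x, 0 ≤ g x) (p : α → ℝ)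
    {s l : ℝ} (hs : 0 < s) (hl : 0 < l) :
    (∫ x, g x ∂ν) * (Real.log (Fintype.card α) -
        Real.log (l ^ (-1 / s) * Real.Gamma (1 / s + 1))) -
      l * ∫ x, g x * (ord p x : ℝ) ^ s ∂ν ≤ ent ν g := by
  set N : ℝ := (Fintype.card α : ℝ) with hN
  have hN0 : 0 < N := by rw [hN]; exact_mod_cast Fintype.card_pos
  have hsum : ∀ f : α → ℝ, ∫ x, f x ∂ν = ∑ x, N⁻¹ * f x := fun f => by
    rw [integral_fintype .of_finite]; simp only [hν, smul_eq_mul]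
  have h1 := sum_mul_log_sub_le (fun x => N⁻¹ * g x) (fun x => Real.exp (-l * (ord p x : ℝ) ^ s))
    (fun x => mul_nonneg (by positivity) (hg x)) fun x => Real.exp_pos _
  have hW : 0 ≤ ∑ x, N⁻¹ * g x :=
    Finset.sum_nonneg fun x _ => mul_nonneg (by positivity) (hg x)
  have h2 : Real.log (∑ x, Real.exp (-l * (ord p x : ℝ) ^ s)) ≤
      Real.log (l ^ (-1 / s) * Real.Gamma (1 / s + 1)) :=
    Real.log_le_log (Finset.sum_pos (fun x _ => Real.exp_pos _) Finset.univ_nonempty)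
      (sum_exp_neg_ord_le p hs hl)
  have h3 := mul_le_mul_of_nonneg_left h2 hW
  have h4 : ∑ x, N⁻¹ * g x * Real.log (N⁻¹ * g x) =
      ∑ x, N⁻¹ * (g x * Real.log (g x)) - (∑ x, N⁻¹ * g x) * Real.log N := by
    rw [Finset.sum_mul, ← Finset.sum_sub_distrib]
    refine Finset.sum_congr rfl fun x _ => ?_
    rcases (hg x).eq_or_lt with h | h
    · simp [← h]
    · rw [Real.log_mul (by positivity) h.ne', Real.log_inv]
      ring
  have h5 : ∑ x, N⁻¹ * g x * Real.log (Real.exp (-l * (ord p x : ℝ) ^ s)) =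
      -(l * ∑ x, N⁻¹ * (g x * (ord p x : ℝ) ^ s)) := by
    rw [Finset.mul_sum, ← Finset.sum_neg_distrib]
    refine Finset.sum_congr rfl fun x _ => ?_
    rw [Real.log_exp]
    ring
  rw [h4, h5] at h1
  unfold ent
  simp only [hsum]
  linarith

lemma rpow_lower_bound {s N m e : ℝ} (hs : 0 < s) (hN : 0 < N) (hm : 0 < m)
    (h : ∀ l : ℝ, 0 < l → Real.log N - Real.log (l ^ (-1 / s) * Real.Gamma (1 / s + 1)) - l * m ≤
      e * Real.log 2) :
    Real.exp (-1) * (s ^ (s - 1) / Real.Gamma (1 / s) ^ s) * (2 : ℝ) ^ (-(s * e)) * N ^ s ≤ m := by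
  have hG : 0 < Real.Gamma (1 / s) := Real.Gamma_pos_of_pos (by positivity)
  -- The maximizer in `l` of `(1/s) log l - l m`.
  have h1 := h (1 / (s * m)) (by positivity)
  rw [Real.Gamma_add_one (by positivity), Real.log_mul (by positivity) (by positivity),
    Real.log_rpow (by positivity), Real.log_mul (by positivity) hG.ne', one_div (s * m),
    Real.log_inv, Real.log_mul hs.ne' hm.ne', one_div s, Real.log_inv] at h1
  rw [← Real.log_le_log_iff (by positivity) hm, Real.log_mul (by positivity) (by positivity),
    Real.log_mul (by positivity) (by positivity), Real.log_mul (by positivity) (by positivity),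
    Real.log_exp, Real.log_div (by positivity) (by positivity), Real.log_rpow hs,
    Real.log_rpow hG, Real.log_rpow (by positivity), Real.log_rpow hN]
  have h2 := mul_le_mul_of_nonneg_left h1 hs.le
  have e1 : s * (Real.log N - (-1 / s * -(Real.log s + Real.log m) +
      (-Real.log s + Real.log (Real.Gamma s⁻¹))) - (s * m)⁻¹ * m) =
      s * Real.log N - (Real.log s + Real.log m) + s * Real.log s -
        s * Real.log (Real.Gamma s⁻¹) - 1 := by
    field_simp
    ring
  rw [e1] at h2
  rw [one_div]
  linarith

/-! ### Power sums and their asymptotics. -/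

lemma sum_range_rpow_le {s : ℝ} (hs : 0 < s) (N : ℕ) :
    ∑ i ∈ Finset.range N, ((i + 1 : ℕ) : ℝ) ^ s ≤ ((N : ℝ) + 1) ^ (s + 1) / (s + 1) := by
  have h := MonotoneOn.sum_le_integral (x₀ := 1) (a := N) (f := fun x : ℝ => x ^ s)
    fun x hx y hy hxy => Real.rpow_le_rpow (by linarith [hx.1]) hxy hs.le
  rw [integral_rpow (.inl (by linarith))] at h
  calc _ = ∑ i ∈ Finset.range N, (1 + (i : ℝ)) ^ s := by
        refine Finset.sum_congr rfl fun i _ => ?_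
        push_cast
        rw [add_comm]
    _ ≤ _ := h
    _ ≤ _ := by
      rw [Real.one_rpow, add_comm (1 : ℝ)]
      gcongr
      linarith

lemma tendsto_rpow_ratio (s : ℝ) :
    Tendsto (fun n : ℕ => ((2 : ℝ) ^ n / ((2 : ℝ) ^ n + 1)) ^ (s + 1)) atTop (nhds 1) := by
  have h : Tendsto (fun n : ℕ => (2 : ℝ) ^ n / ((2 : ℝ) ^ n + 1)) atTop (nhds 1) := by
    have h1 : Tendsto (fun n : ℕ => (1 + ((2 : ℝ) ^ n)⁻¹)⁻¹) atTop (nhds (1 + 0)⁻¹) :=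
      ((tendsto_inv_atTop_zero.comp (tendsto_pow_atTop_atTop_of_one_lt one_lt_two)).const_add
        1).inv₀ (by norm_num)
    rw [add_zero, inv_one] at h1
    refine h1.congr fun n => ?_
    have : (0 : ℝ) < 2 ^ n := by positivity
    field_simp
  simpa using h.rpow_const (p := s + 1) (.inl one_ne_zero)

/-! ### Joint law of the input block and the help bit. -/

section blockLaw

variable {𝒳 𝒴 : Type*} [MeasurableSpace 𝒳] [MeasurableSpace 𝒴]

instance (ν : Measure 𝒳) [IsProbabilityMeasure ν] (W : Kernel 𝒳 𝒴) [IsMarkovKernel W] (n : ℕ) :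
    IsProbabilityMeasure (blockLaw ν W n) := by
  unfold blockLaw
  infer_instance

lemma measurable_inputBlock {n : ℕ} :
    Measurable (inputBlock : (Fin n → 𝒳 × 𝒴) → Fin n → 𝒳) := by
  unfold inputBlock
  fun_prop

lemma measurable_outputBlock {n : ℕ} :
    Measurable (outputBlock : (Fin n → 𝒳 × 𝒴) → Fin n → 𝒴) := by
  unfold outputBlock
  fun_prop

variable [Fintype 𝒳] [MeasurableSingletonClass 𝒳] (ν : Measure 𝒳) [IsProbabilityMeasure ν]
  (W : Kernel 𝒳 𝒴) [IsMarkovKernel W] {n : ℕ}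

/-- The product of the measures `ν {x i} • W (x i)` is identified on boxes in two ways: as the
output law restricted to `X^n = x`, and as a scalar times the product channel. -/
lemma blockLaw_inter_preimage (x : Fin n → 𝒳) {A : Set (Fin n → 𝒴)} (hA : MeasurableSet A) :
    blockLaw ν W n (inputBlock ⁻¹' {x} ∩ outputBlock ⁻¹' A) =
      Measure.pi (fun _ : Fin n => ν) {x} * Measure.pi (fun i => W (x i)) A := by
  have hfin : ∀ i, IsFiniteMeasure (ν {x i} • W (x i)) := fun i =>
    Measure.smul_finite _ (measure_ne_top _ _)
  have h1 : Measure.pi (fun i => ν {x i} • W (x i)) =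
      ((blockLaw ν W n).restrict (inputBlock ⁻¹' {x})).map outputBlock := by
    refine Measure.pi_eq fun t ht => ?_
    rw [Measure.map_apply measurable_outputBlock (.univ_pi ht),
      Measure.restrict_apply (measurable_outputBlock (.univ_pi ht))]
    have : outputBlock ⁻¹' Set.univ.pi t ∩ inputBlock ⁻¹' {x} =
        Set.univ.pi fun i => ({x i} : Set 𝒳) ×ˢ t i := by
      ext ω
      simp only [Set.mem_inter_iff, Set.mem_preimage, Set.mem_univ_pi, Set.mem_singleton_iff,
        Set.mem_prod, funext_iff, inputBlock, outputBlock, forall_and]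
      exact and_comm
    rw [this, blockLaw, Measure.pi_pi]
    refine Finset.prod_congr rfl fun i _ => ?_
    rw [Measure.compProd_apply_prod (measurableSet_singleton _) (ht i), lintegral_singleton,
      Measure.smul_apply, smul_eq_mul, mul_comm]
  have h2 : Measure.pi (fun i => ν {x i} • W (x i)) =
      (∏ i, ν {x i}) • Measure.pi fun i => W (x i) := by
    refine Measure.pi_eq fun t ht => ?_
    simp [Measure.pi_pi, Finset.prod_mul_distrib]
  have h3 := congrArg (fun m => m A) (h1.symm.trans h2)
  simp only [Measure.smul_apply, smul_eq_mul] at h3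
  rw [Measure.map_apply measurable_outputBlock hA,
    Measure.restrict_apply (measurable_outputBlock hA), Set.inter_comm] at h3
  rw [h3, Measure.pi_singleton]

lemma integral_blockLaw {f : (Fin n → 𝒴) → Bool} (hf : Measurable f)
    (F : (Fin n → 𝒳) → Bool → ℝ) :
    ∫ ω, F (inputBlock ω) (f (outputBlock ω)) ∂(blockLaw ν W n) =
      ∑ b, ∫ x, (Measure.pi fun i => W (x i)).real (f ⁻¹' {b}) * F x b
        ∂(Measure.pi fun _ : Fin n => ν) := by
  classical
  have hZ : Measurable fun ω : Fin n → 𝒳 × 𝒴 => (inputBlock ω, f (outputBlock ω)) :=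
    measurable_inputBlock.prodMk (hf.comp measurable_outputBlock)
  have : IsProbabilityMeasure ((blockLaw ν W n).map
      fun ω : Fin n → 𝒳 × 𝒴 => (inputBlock ω, f (outputBlock ω))) :=
    Measure.isProbabilityMeasure_map hZ.aemeasurable
  have h1 := integral_map hZ.aemeasurable (μ := blockLaw ν W n)
    (f := fun z : (Fin n → 𝒳) × Bool => F z.1 z.2) (measurable_of_finite _).aestronglyMeasurable
  rw [← h1, integral_fintype .of_finite, Fintype.sum_prod_type_right]
  refine Finset.sum_congr rfl fun b _ => ?_
  rw [integral_fintype .of_finite]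
  refine Finset.sum_congr rfl fun x _ => ?_
  have h2 : ((blockLaw ν W n).map fun ω : Fin n → 𝒳 × 𝒴 =>
      (inputBlock ω, f (outputBlock ω))).real {(x, b)} =
      (Measure.pi fun _ : Fin n => ν).real {x} * (Measure.pi fun i => W (x i)).real (f ⁻¹' {b}) := by
    rw [measureReal_def, Measure.map_apply hZ (measurableSet_singleton _), measureReal_def,
      measureReal_def, ← ENNReal.toReal_mul,
      ← blockLaw_inter_preimage ν W x (hf (measurableSet_singleton b))]
    congr 2
    ext ω
    simp
  rw [h2]
  simp only [smul_eq_mul]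
  ring

lemma integral_blockLaw_input (F : (Fin n → 𝒳) → ℝ) :
    ∫ ω, F (inputBlock ω) ∂(blockLaw ν W n) = ∫ x, F x ∂(Measure.pi fun _ : Fin n => ν) := by
  have h := integral_blockLaw ν W (n := n) (f := fun _ => true) measurable_const fun x _ => F x
  rw [h]
  simp

end blockLaw

/-! ### Bounds for uniform bits at fixed block length. -/

lemma uniformBit_singleton (b : Bool) : uniformBit {b} = 2⁻¹ := by
  rw [uniformBit, PMF.toMeasure_apply_singleton _ _ (measurableSet_singleton b)]
  simp

lemma pi_uniformBit_real_singleton {n : ℕ} (x : Fin n → Bool) :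
    (Measure.pi fun _ : Fin n => uniformBit).real {x} =
      (Fintype.card (Fin n → Bool) : ℝ)⁻¹ := by
  rw [measureReal_def, Measure.pi_singleton]
  simp [uniformBit_singleton]

lemma ent_indicator {α : Type*} [MeasurableSpace α] (μ : Measure α) {A : Set α}
    (hA : MeasurableSet A) : ent μ (A.indicator 1) = Real.negMulLog (μ.real A) := by
  have : ∀ x, A.indicator (1 : α → ℝ) x * Real.log (A.indicator 1 x) = 0 := fun x => by
    by_cases hx : x ∈ A <;> simp [hx]
  simp [ent, this, integral_indicator_one hA, Real.negMulLog]

section main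

variable {𝒴 : Type*} [MeasurableSpace 𝒴] (W : Kernel Bool 𝒴) [IsMarkovKernel W] {s : ℝ}

lemma le_condGuessingMoment (hs : 0 < s) {n : ℕ} {f : (Fin n → 𝒴) → Bool} (hf : Measurable f) :
    Real.exp (-1) * (s ^ (s - 1) / Real.Gamma (1 / s) ^ s) *
        (2 : ℝ) ^ (-(s * (sdpiConstant (W ∘ₘ uniformBit) (posterior W uniformBit)).toReal)) *
        ((2 : ℝ) ^ n) ^ s ≤
      condGuessingMoment s (blockLaw uniformBit W n) inputBlock (fun ω => f (outputBlock ω)) := by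
  set η := (sdpiConstant (W ∘ₘ uniformBit) (posterior W uniformBit)).toReal with hη
  have hη0 : 0 ≤ η := ENNReal.toReal_nonneg
  set P := blockLaw uniformBit W n with hP
  set ν := Measure.pi fun _ : Fin n => uniformBit with hν
  set μ := Measure.pi fun _ : Fin n => W ∘ₘ uniformBit with hμ
  set q : Bool → (Fin n → Bool) → ℝ := fun b x =>
    (P[|(fun ω => f (outputBlock ω)) ⁻¹' {b}]).real (inputBlock ⁻¹' {x}) with hq
  set m := condGuessingMoment s P inputBlock (fun ω => f (outputBlock ω)) with hm
  set g : Bool → (Fin n → Bool) → ℝ := fun b x =>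
    (Measure.pi fun i => W (x i)).real (f ⁻¹' {b}) with hg
  have hmsum : m = ∑ b, ∫ x, g b x * (ord (q b) x : ℝ) ^ s ∂ν :=
    integral_blockLaw uniformBit W hf fun x b => (ord (q b) x : ℝ) ^ s
  have hg0 : ∀ b x, 0 ≤ g b x := fun b x => measureReal_nonneg
  have hgsum : ∑ b, ∫ x, g b x ∂ν = 1 := by
    have := integral_blockLaw uniformBit W hf fun _ _ => (1 : ℝ)
    simp only [mul_one] at this
    rw [← this]
    simp
  -- Needed only for `0 < m`, so that `l = 1 / (s m)` is admissible.
  have hm1 : 1 ≤ m := by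
    rw [hmsum, ← hgsum]
    refine Finset.sum_le_sum fun b _ => integral_mono .of_finite .of_finite fun x => ?_
    exact le_mul_of_one_le_right (hg0 b x)
      (Real.one_le_rpow (by exact_mod_cast one_le_ord (q b) x) hs.le)
  have hA : ∀ b, MeasurableSet (f ⁻¹' {b}) := fun b => hf (measurableSet_singleton b)
  have hcontr := (contractsEnt_sdpiConstant W uniformBit).pi n
  have hent : ∑ b, ent ν (g b) ≤ η * Real.log 2 := by
    have h1 : ∀ b, ent ν (g b) ≤ η * Real.negMulLog (μ.real (f ⁻¹' {b})) := fun b => by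
      have := hcontr.ent_le ((f ⁻¹' {b}).indicator 1) (measurable_one.indicator (hA b))
        fun y => by by_cases hy : y ∈ f ⁻¹' {b} <;> simp [Set.indicator, hy]
      rw [ent_indicator _ (hA b)] at this
      simpa only [integral_indicator_one (hA b)] using this
    refine (Finset.sum_le_sum fun b _ => h1 b).trans ?_
    rw [← Finset.mul_sum]
    refine mul_le_mul_of_nonneg_left ?_ hη0
    have h2 : f ⁻¹' {false} = (f ⁻¹' {true})ᶜ := by
      ext y
      simp
    rw [Fintype.sum_bool, h2, probReal_compl_eq_one_sub (hA true),
      ← Real.binEntropy_eq_negMulLog_add_negMulLog_one_sub]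
    exact Real.binEntropy_le_log_two
  refine rpow_lower_bound hs (by positivity) (by linarith) fun l hl => ?_
  refine le_trans ?_ hent
  have hN : (Fintype.card (Fin n → Bool) : ℝ) = 2 ^ n := by simp
  have h3 := Finset.sum_le_sum fun b (_ : b ∈ Finset.univ) =>
    le_ent_of_uniform ν pi_uniformBit_real_singleton (g b) (hg0 b) (q b) hs hl
  rw [Finset.sum_sub_distrib, ← Finset.sum_mul, ← Finset.mul_sum, ← hmsum, hgsum, one_mul, hN]
    at h3
  exact h3

lemma guessingMoment_eq (n : ℕ) :
    guessingMoment s (blockLaw uniformBit W n) inputBlock =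
      ((2 : ℝ) ^ n)⁻¹ * ∑ i ∈ Finset.range (2 ^ n), ((i + 1 : ℕ) : ℝ) ^ s := by
  unfold guessingMoment
  rw [integral_blockLaw_input uniformBit W fun x => (ord (fun x =>
    (blockLaw uniformBit W n).real (inputBlock ⁻¹' {x})) x : ℝ) ^ s, integral_fintype .of_finite]
  simp only [pi_uniformBit_real_singleton, smul_eq_mul]
  rw [← Finset.mul_sum, sum_ord _ fun k => (k : ℝ) ^ s]
  simp

lemma condGuessingMoment_const (n : ℕ) :
    condGuessingMoment s (blockLaw uniformBit W n) inputBlock (fun _ => true) =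
      guessingMoment s (blockLaw uniformBit W n) inputBlock := by
  unfold condGuessingMoment guessingMoment
  simp

lemma guessingMoment_pos (n : ℕ) :
    0 < guessingMoment s (blockLaw uniformBit W n) inputBlock := by
  rw [guessingMoment_eq]
  refine mul_pos (by positivity) (Finset.sum_pos (fun i _ => by positivity) ?_)
  simp

lemma guessingMoment_le (hs : 0 < s) (n : ℕ) :
    guessingMoment s (blockLaw uniformBit W n) inputBlock ≤
      ((2 : ℝ) ^ n)⁻¹ * (((2 : ℝ) ^ n + 1) ^ (s + 1) / (s + 1)) := by
  rw [guessingMoment_eq]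
  have := sum_range_rpow_le hs (2 ^ n)
  push_cast at this
  push_cast
  gcongr

end main

end GuessingHelp

/-! ### Passage to the limit. -/

open GuessingHelp in
theorem mainTheorem5 {𝒴 : Type*} [MeasurableSpace 𝒴]
    (W : ProbabilityTheory.Kernel Bool 𝒴) [ProbabilityTheory.IsMarkovKernel W]
    (s : ℝ) (hs : 0 < s) :
    Real.exp (-1) * (s ^ (s - 1) * (s + 1) / Real.Gamma (1 / s) ^ s) *
        (2 : ℝ) ^ (-(s * (GuessingHelp.sdpiConstant (W ∘ₘ GuessingHelp.uniformBit)
          (ProbabilityTheory.posterior W GuessingHelp.uniformBit)).toReal)) ≤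
      GuessingHelp.guessingEfficiency s GuessingHelp.uniformBit W := by
  have hG : 0 < Real.Gamma (1 / s) := Real.Gamma_pos_of_pos (by positivity)
  set E := (2 : ℝ) ^ (-(s * (sdpiConstant (W ∘ₘ uniformBit)
    (posterior W uniformBit)).toReal)) with hE
  set C := Real.exp (-1) * (s ^ (s - 1) / Real.Gamma (1 / s) ^ s) * E with hC
  have hC0 : 0 < C := by positivity
  have hconst : Real.exp (-1) * (s ^ (s - 1) * (s + 1) / Real.Gamma (1 / s) ^ s) * E =
      C * (s + 1) * 1 := by
    rw [hC]
    ring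
  have hlim := (tendsto_rpow_ratio s).const_mul (C * (s + 1))
  have hlow : ∀ n : ℕ, C * (s + 1) * ((2 : ℝ) ^ n / ((2 : ℝ) ^ n + 1)) ^ (s + 1) ≤
      ⨅ f : {f : (Fin n → 𝒴) → Bool // Measurable f},
        condGuessingMoment s (blockLaw uniformBit W n) inputBlock
          (fun ω => f.1 (outputBlock ω)) /
            guessingMoment s (blockLaw uniformBit W n) inputBlock := fun n => by
    have : Nonempty {f : (Fin n → 𝒴) → Bool // Measurable f} :=
      ⟨⟨fun _ => true, measurable_const⟩⟩
    refine le_ciInf fun f => ?_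
    rw [le_div_iff₀ (guessingMoment_pos W n)]
    refine le_trans (b := C * ((2 : ℝ) ^ n) ^ s) ?_ (le_condGuessingMoment W hs f.2)
    refine (mul_le_mul_of_nonneg_left (guessingMoment_le W hs n) (by positivity)).trans
      (le_of_eq ?_)
    have hN : (0 : ℝ) < 2 ^ n := by positivity
    rw [Real.div_rpow (by positivity) (by positivity), Real.rpow_add_one hN.ne']
    have : ((2 : ℝ) ^ n + 1) ^ (s + 1) ≠ 0 := by positivity
    field_simp
  -- A constant help bit gives ratio `1`; this upper bound is needed because an unbounded real
  -- `limsup` would take a default value.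
  have hup : ∀ n : ℕ, (⨅ f : {f : (Fin n → 𝒴) → Bool // Measurable f},
        condGuessingMoment s (blockLaw uniformBit W n) inputBlock
          (fun ω => f.1 (outputBlock ω)) /
            guessingMoment s (blockLaw uniformBit W n) inputBlock) ≤ 1 := fun n => by
    refine (ciInf_le ⟨0, ?_⟩ ⟨fun _ => true, measurable_const⟩).trans ?_
    · rintro _ ⟨f, rfl⟩
      exact div_nonneg (integral_nonneg fun ω => by positivity) (guessingMoment_pos W n).le
    · simp only [condGuessingMoment_const]
      exact div_self_le_one _
  rw [hconst, guessingEfficiency]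
  refine le_limsup_of_le (isBoundedUnder_of_eventually_le (Eventually.of_forall hup))
    fun b hb => ?_
  exact le_of_tendsto hlim (hb.mono fun n hn => (hlow n).trans hn)
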